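/- Let $R$ be a ring with a filtration $FR=(F_nR)_{n\in\mathbb Z}$: an ascending chain of additive subgroups with $1\in F_0R$, $F_mR\,F_nR\subseteq F_{m+n}R$ and $\bigcup_n F_nR=R$. Assume that $FR$ is Zariskian, i.e. $F_{-1}R$ is contained in the Jacobson radical of $F_0R$ and the Rees ring $\widetilde R=\sum_n F_nR\,X^n\subseteq R[X,X^{-1}]$ is left Noetherian. (Then $FR$ is automatically separated.) Let $\kappa$ be a kernel functor on $R$-mod (a left exact idempotent radical), and let $\mathcal L(\kappa)=\{L\le {}_RR : \kappa(R/L)=R/L\}$ be its Gabriel filter. Write $Q_\kappa(M)=\varinjlim_{I\in\mathcal L(\kappa)}\mathrm{Hom}_R(I,M/\kappa(M))$ for the localization of a left $R$-module $M$, and $j_\kappa:M\to Q_\kappa(M)$ for the localization morphism. A filtered $R$-module is a left $R$-module $M$ with an ascending chain of additive subgroups $F_nM$ ($n\in\mathbb Z$) such that $F_mR\,F_nM\subseteq F_{m+n}M$ and $\bigcup_n F_nM=M$; quotients of $M$ carry the image filtration. The filtration is separated if $\bigcap_nF_nM=0$. For a left ideal $I$ put $F_\gamma I=I\cap F_\gamma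 R$. A filtered module $N$ is called $\kappa$-separated if $m\in\kappa(N)$ whenever $m\in F_nN\setminus F_{n-1}N$ for some $n$ and there is $I\in\mathcal L(\kappa)$ with $(F_\gamma I)\,m\subseteq F_{\gamma+n-1}N$ for all $\gamma\in\mathbb Z$. A homomorphism $f:M\to N$ of filtered modules is strict filtered if $f(F_nM)=F_nN\cap f(M)$ for all $n$. The quotient filtration on $Q_\kappa(M)$ is defined by $$F_\gamma Q_\kappa(M)=\{q\in Q_\kappa(M) : \exists I\in\mathcal L(\kappa)\ \text{with}\ (F_nI)\,q\subseteq j_\kappa(F_{n+\gamma}M)\ \text{for all } n\in\mathbb Z\}.$$ **Theorem.** 1. Let $M$ be a filtered $R$-module such that $M/\kappa(M)$ is $\kappa$-separated. Then $FQ_\kappa(M)$ is an (exhaustive) filtration making $Q_\kappa(M)$ a filtered $R$-module, and $j_\kappa:M\to Q_\kappa(M)$ is a strict filtered morphism. If the filtration of $M/\kappa(M)$ is separated, then so is $FQ_\kappa(M)$. 2. If $R/\kappa(R)$ is $\kappa$-separated, then $FQ_\kappa(R)$ is a separated (exhaustive) filtration of the ring $Q_\kappa(R)$, and $j_\kappa:R\to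 Q_\kappa(R)$ is a ring homomorphism and a strict filtered morphism. 3. If $M$ is as in 1, then $Q_\kappa(M)$ with $FQ_\kappa(M)$ is a filtered $Q_\kappa(R)$-module with respect to $FQ_\kappa(R)$, that is, $F_pQ_\kappa(R)\,F_qQ_\kappa(M)\subseteq F_{p+q}Q_\kappa(M)$ for all $p,q\in\mathbb Z$ (and, when $R/\kappa(R)$ is $\kappa$-separated, $Q_\kappa(R)$ is a filtered ring by 2). -/

import Mathlib

universe u

/-! ### Filtered rings and modules, Rees rings, Zariskian filtrations -/

/-- `FR` is a (`ℤ`-indexed, ascending, exhaustive) filtration of the ring `R`. -/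
structure IsFilteredRing {R : Type u} [Ring R] (FR : ℤ → AddSubgroup R) : Prop where
  mono : Monotone FR
  one_mem : (1 : R) ∈ FR 0
  mul_mem : ∀ {m n : ℤ} {a b : R}, a ∈ FR m → b ∈ FR n → a * b ∈ FR (m + n)
  exhaustive : ∀ a : R, ∃ n : ℤ, a ∈ FR n

/-- `FM` is an (ascending, exhaustive) filtration of the left `R`-module `M`, compatible with
the filtration `FR` of `R`. -/
structure IsFilteredModule {R : Type u} [Ring R] {M : Type u} [AddCommGroup M] [Module R M]
    (FR : ℤ → AddSubgroup R) (FM : ℤ → AddSubgroup M) : Prop where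
  mono : Monotone FM
  smul_mem : ∀ {m n : ℤ} {a : R} {x : M}, a ∈ FR m → x ∈ FM n → a • x ∈ FM (m + n)
  exhaustive : ∀ x : M, ∃ n : ℤ, x ∈ FM n

/-- A filtration is separated if the intersection of its terms is zero. -/
def IsSeparatedFiltration {M : Type u} [AddCommGroup M] (FM : ℤ → AddSubgroup M) : Prop :=
  ⨅ n, FM n = ⊥

/-- `f` is a strict filtered morphism (of degree `0`): `f (F_n M) = F_n N ∩ f (M)` for all `n`;
in particular `f (F_n M) ⊆ F_n N`. -/
def IsStrictFilteredHom {M N : Type u} [AddCommGroup M] [AddCommGroup N]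
    (FM : ℤ → AddSubgroup M) (FN : ℤ → AddSubgroup N) (f : M →+ N) : Prop :=
  ∀ n, (FM n).map f = FN n ⊓ f.range

/-- The filtration induced on a quotient module `M ⧸ N`: the image of `F_n M`. -/
def quotFiltration {R : Type u} [Ring R] {M : Type u} [AddCommGroup M] [Module R M]
    (FM : ℤ → AddSubgroup M) (N : Submodule R M) (n : ℤ) : AddSubgroup (M ⧸ N) :=
  (FM n).map N.mkQ.toAddMonoidHom

namespace IsFilteredRing

variable {R : Type u} [Ring R] {FR : ℤ → AddSubgroup R}

/-- The subring `F_0 R` of a filtered ring. -/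
def zeroSubring (h : IsFilteredRing FR) : Subring R where
  carrier := FR 0
  mul_mem' ha hb := by simpa using h.mul_mem ha hb
  one_mem' := h.one_mem
  add_mem' := (FR 0).add_mem
  zero_mem' := (FR 0).zero_mem
  neg_mem' := (FR 0).neg_mem

open LaurentPolynomial in
/-- The Rees ring `∑ (F_n R) T ^ n`, as a subring of `R[T;T⁻¹]`. -/
def reesRing (h : IsFilteredRing FR) : Subring R[T;T⁻¹] where
  carrier := {f | ∀ n : ℤ, f.coeff n ∈ FR n}
  mul_mem' {f g} hf hg n := by
    classical
    rw [AddMonoidAlgebra.coeff_mul]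
    refine (FR n).sum_mem fun i _ => (FR n).sum_mem fun j _ => ?_
    change (if i + j = n then f.coeff i * g.coeff j else 0) ∈ FR n
    split_ifs with hij
    · exact hij ▸ h.mul_mem (hf i) (hg j)
    · exact (FR n).zero_mem
  one_mem' n := by
    classical
    rw [AddMonoidAlgebra.one_def, AddMonoidAlgebra.coeff_single, Finsupp.single_apply]
    split_ifs with hn
    · exact hn ▸ h.one_mem
    · exact (FR n).zero_mem
  add_mem' {f g} hf hg n := (FR n).add_mem (hf n) (hg n)
  zero_mem' n := (FR n).zero_mem
  neg_mem' {f} hf n := (FR n).neg_mem (hf n)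

/-- A filtration is (left) Zariskian if `F_{-1} R` is contained in the Jacobson radical of `F_0 R`
and the Rees ring is (left) Noetherian. -/
structure IsZariskian (h : IsFilteredRing FR) : Prop where
  le_jacobson : ∀ a : h.zeroSubring, (a : R) ∈ FR (-1) → a ∈ Ring.jacobson h.zeroSubring
  noetherian : IsNoetherianRing h.reesRing

end IsFilteredRing

/-! ### Kernel functors and their Gabriel filters -/

/-- A kernel functor on `R`-mod: a subfunctor of the identity functor which is left exact,
idempotent, and radical. -/
structure KernelFunctor (R : Type u) [Ring R] where
  /-- the submodule `κ(M)` of `M` -/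
  obj : ∀ (M : Type u) [AddCommGroup M] [Module R M], Submodule R M
  map_mem : ∀ {M N : Type u} [AddCommGroup M] [Module R M] [AddCommGroup N] [Module R N]
    (f : M →ₗ[R] N) {x : M}, x ∈ obj M → f x ∈ obj N
  /-- if `0 → A → B → C` is exact, then `0 → κ(A) → κ(B) → κ(C)` is exact -/
  left_exact : ∀ {A B C : Type u} [AddCommGroup A] [Module R A] [AddCommGroup B] [Module R B]
    [AddCommGroup C] [Module R C] (f : A →ₗ[R] B) (g : B →ₗ[R] C),
    Function.Injective f → Function.Exact f g →
      ∀ b ∈ obj B, g b = 0 → ∃ a ∈ obj A, f a = b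
  idempotent : ∀ (M : Type u) [AddCommGroup M] [Module R M], obj (obj M) = ⊤
  radical : ∀ (M : Type u) [AddCommGroup M] [Module R M], obj (M ⧸ obj M) = ⊥

namespace KernelFunctor

variable {R : Type u} [Ring R] (κ : KernelFunctor R)

/-- The filter `𝓛(κ)` of those left ideals `L` for which `R ⧸ L` is `κ`-torsion. -/
def filter : Set (Submodule R R) := {L | κ.obj (R ⧸ L) = ⊤}

variable {M : Type u} [AddCommGroup M] [Module R M]

/-- The left ideal `(N : x)` of those `a` with `a • x ∈ N`. -/
def colon (N : Submodule R M) (x : M) : Submodule R R where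
  carrier := {a | a • x ∈ N}
  add_mem' {a b} ha hb := by
    rw [Set.mem_ofPred_eq, add_smul]; exact N.add_mem ha hb
  zero_mem' := by rw [Set.mem_ofPred_eq, zero_smul]; exact N.zero_mem
  smul_mem' c a ha := by
    rw [Set.mem_ofPred_eq, smul_eq_mul, mul_smul]; exact N.smul_mem c ha

@[simp] theorem mem_colon {N : Submodule R M} {x : M} {a : R} : a ∈ colon N x ↔ a • x ∈ N :=
  Iff.rfl

theorem mem_of_injective {N : Type u} [AddCommGroup N] [Module R N] (f : M →ₗ[R] N)
    (hf : Function.Injective f) {x : M} (hx : f x ∈ κ.obj N) : x ∈ κ.obj M := by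
  obtain ⟨a, ha, hax⟩ := κ.left_exact f (LinearMap.range f).mkQ hf
    (LinearMap.exact_map_mkQ_range f) (f x) hx (by simp)
  exact hf hax ▸ ha

theorem mem_filter_iff {L : Submodule R R} :
    L ∈ κ.filter ↔ L.mkQ 1 ∈ κ.obj (R ⧸ L) := by
  refine ⟨fun h => by rw [show κ.obj (R ⧸ L) = ⊤ from h]; trivial, fun h => ?_⟩
  refine Submodule.eq_top_iff'.2 fun x => ?_
  obtain ⟨a, rfl⟩ := L.mkQ_surjective x
  have := (κ.obj (R ⧸ L)).smul_mem a h
  rwa [← map_smul, smul_eq_mul, mul_one] at this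

theorem mem_obj_iff_colon {x : M} : x ∈ κ.obj M ↔ colon (⊥ : Submodule R M) x ∈ κ.filter := by
  rw [mem_filter_iff]
  have hker : colon (⊥ : Submodule R M) x ≤ LinearMap.ker (LinearMap.toSpanSingleton R M x) :=
    fun a ha => by simpa using ha
  have hval : ∀ a : R, (colon (⊥ : Submodule R M) x).liftQ _ hker
      ((colon (⊥ : Submodule R M) x).mkQ a) = a • x := fun a => by simp
  constructor
  · intro h
    refine κ.mem_of_injective ((colon (⊥ : Submodule R M) x).liftQ _ hker) ?_ ?_
    · rw [← LinearMap.ker_eq_bot]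
      exact Submodule.ker_liftQ_eq_bot _ _ _ fun a ha => by simpa using ha
    · rwa [hval, one_smul]
  · intro h
    have := κ.map_mem ((colon (⊥ : Submodule R M) x).liftQ _ hker) h
    rwa [hval, one_smul] at this

theorem filter_mono {I J : Submodule R R} (h : I ≤ J) (hI : I ∈ κ.filter) : J ∈ κ.filter := by
  rw [mem_filter_iff] at *
  simpa using κ.map_mem (Submodule.mapQ I J LinearMap.id h) hI

theorem top_mem_filter : (⊤ : Submodule R R) ∈ κ.filter := by
  rw [mem_filter_iff]
  have : (⊤ : Submodule R R).mkQ 1 = 0 :=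
    (Submodule.Quotient.mk_eq_zero _).2 Submodule.mem_top
  rw [this]
  exact Submodule.zero_mem _

/-- An element is `κ`-torsion if and only if it is annihilated by some member of `𝓛(κ)`. -/
theorem mem_obj_iff {x : M} : x ∈ κ.obj M ↔ ∃ I ∈ κ.filter, ∀ a ∈ I, a • x = 0 := by
  rw [mem_obj_iff_colon]
  refine ⟨fun h => ⟨_, h, fun a ha => by simpa using ha⟩, ?_⟩
  rintro ⟨I, hI, h⟩
  exact κ.filter_mono (fun a ha => by simpa using h a ha) hI

theorem inf_mem_filter {I J : Submodule R R} (hI : I ∈ κ.filter) (hJ : J ∈ κ.filter) :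
    I ⊓ J ∈ κ.filter := by
  have h1 := κ.map_mem (LinearMap.inl R (R ⧸ I) (R ⧸ J)) (κ.mem_filter_iff.1 hI)
  have h2 := κ.map_mem (LinearMap.inr R (R ⧸ I) (R ⧸ J)) (κ.mem_filter_iff.1 hJ)
  have h3 := κ.mem_obj_iff_colon.1 (Submodule.add_mem _ h1 h2)
  refine κ.filter_mono (fun a ha => ?_) h3
  simpa [← Submodule.Quotient.mk_smul, Prod.ext_iff] using ha

theorem colon_mem_filter {I : Submodule R R} (hI : I ∈ κ.filter) (r : R) :
    colon I r ∈ κ.filter := by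
  have h : I.mkQ r ∈ κ.obj (R ⧸ I) := by
    rw [show κ.obj (R ⧸ I) = ⊤ from hI]; trivial
  refine κ.filter_mono (fun a ha => ?_) (κ.mem_obj_iff_colon.1 h)
  rw [mem_colon, ← map_smul] at ha
  simpa using ha

theorem mem_filter_of_colon {I J : Submodule R R} (hI : I ∈ κ.filter)
    (h : ∀ a ∈ I, colon J a ∈ κ.filter) : J ∈ κ.filter := by
  rw [mem_filter_iff]
  have key : (κ.obj (R ⧸ J)).mkQ (J.mkQ 1) ∈ κ.obj ((R ⧸ J) ⧸ κ.obj (R ⧸ J)) := by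
    refine κ.mem_obj_iff.2 ⟨I, hI, fun a ha => ?_⟩
    rw [← map_smul, ← map_smul, smul_eq_mul, mul_one, Submodule.mkQ_apply,
      Submodule.Quotient.mk_eq_zero]
    refine κ.mem_obj_iff.2 ⟨_, h a ha, fun b hb => ?_⟩
    rw [← map_smul, Submodule.mkQ_apply, Submodule.Quotient.mk_eq_zero]
    exact hb
  rw [κ.radical] at key
  simpa using key

/-- `M ⧸ κ(M)` has no nonzero torsion elements. -/
theorem quot_eq_zero {x : M ⧸ κ.obj M} {I : Submodule R R} (hI : I ∈ κ.filter)
    (h : ∀ a ∈ I, a • x = 0) : x = 0 := by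
  have : x ∈ κ.obj (M ⧸ κ.obj M) := κ.mem_obj_iff.2 ⟨I, hI, h⟩
  rwa [κ.radical, Submodule.mem_bot] at this

/-- `κ`-separatedness of a filtered module `M`: if `m ∈ F_n M` and `m ∉ F_{n-1} M`, and if there is
`I ∈ 𝓛(κ)` such that `(F_γ I) m ⊆ F_{γ+n-1} M` for all `γ`, where `F_γ I = I ∩ F_γ R`,
then `m ∈ κ(M)`. -/
def IsSeparated (FR : ℤ → AddSubgroup R) (FM : ℤ → AddSubgroup M) : Prop :=
  ∀ (n : ℤ) (m : M), m ∈ FM n → m ∉ FM (n - 1) →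
    (∃ I ∈ κ.filter, ∀ γ : ℤ, ∀ a ∈ I, a ∈ FR γ → a • m ∈ FM (γ + n - 1)) → m ∈ κ.obj M

/-! ### The localization `Q_κ(M) = colim_{I ∈ 𝓛(κ)} Hom_R(I, M / κ(M))` -/

/-- The index set of the colimit: `𝓛(κ)`, ordered by reverse inclusion. -/
abbrev Idx : Type u := (κ.filter)ᵒᵈ

/-- The left ideal belonging to an index. -/
def Idx.ideal {κ : KernelFunctor R} (i : κ.Idx) : Submodule R R := (OrderDual.ofDual i).1

theorem Idx.mem {κ : KernelFunctor R} (i : κ.Idx) : i.ideal ∈ κ.filter := (OrderDual.ofDual i).2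

/-- The index of a member of `𝓛(κ)`. -/
def idx {I : Submodule R R} (hI : I ∈ κ.filter) : κ.Idx := OrderDual.toDual ⟨I, hI⟩

instance : Nonempty κ.Idx := ⟨κ.idx κ.top_mem_filter⟩

instance : IsDirectedOrder κ.Idx :=
  ⟨fun i j => ⟨κ.idx (κ.inf_mem_filter i.mem j.mem),
    show i.ideal ⊓ j.ideal ≤ i.ideal from inf_le_left,
    show i.ideal ⊓ j.ideal ≤ j.ideal from inf_le_right⟩⟩

variable (M) in
/-- `Hom_R(I, M / κ(M))`. -/
abbrev HomAt (i : κ.Idx) : Type u := i.ideal →ₗ[R] (M ⧸ κ.obj M)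

variable (M) in
/-- Restriction of homomorphisms to a smaller left ideal. -/
def restr (i j : κ.Idx) (h : i ≤ j) : κ.HomAt M i →+ κ.HomAt M j where
  toFun f := f.comp (Submodule.inclusion (show j.ideal ≤ i.ideal from h))
  map_zero' := rfl
  map_add' _ _ := rfl

instance : DirectedSystem (κ.HomAt M) fun i j h => κ.restr M i j h where
  map_self _ _ := rfl
  map_map _ _ _ _ _ _ := rfl

open Classical in
variable (M) in
/-- The localization `Q_κ(M)` of `M` at `κ`. -/
def Loc : Type u := AddCommGroup.DirectLimit (κ.HomAt M) (κ.restr M)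

namespace Loc

variable {κ}

noncomputable section

open Classical in
instance : AddCommGroup (κ.Loc M) :=
  inferInstanceAs (AddCommGroup (AddCommGroup.DirectLimit (κ.HomAt M) (κ.restr M)))

open Classical in
/-- The class in `Q_κ(M)` of a homomorphism `I → M / κ(M)`. -/
def of (i : κ.Idx) : κ.HomAt M i →+ κ.Loc M :=
  AddCommGroup.DirectLimit.of (κ.HomAt M) (κ.restr M) i

theorem of_restr {i j : κ.Idx} (h : i ≤ j) (f : κ.HomAt M i) :
    of j (κ.restr M i j h f) = of i f := by
  classical
  exact AddCommGroup.DirectLimit.of_f (f := κ.restr M) h f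

theorem exists_of (q : κ.Loc M) : ∃ (i : κ.Idx) (f : κ.HomAt M i), of i f = q := by
  classical
  exact AddCommGroup.DirectLimit.induction_on (f := κ.restr M)
    (C := fun q => ∃ (i : κ.Idx) (f : κ.HomAt M i), of i f = q) q fun i f => ⟨i, f, rfl⟩

theorem of_eq_zero {i : κ.Idx} {f : κ.HomAt M i} : of i f = 0 ↔ f = 0 := by
  classical
  refine ⟨fun h => ?_, fun h => by rw [h, map_zero]⟩
  obtain ⟨j, hij, hj⟩ := AddCommGroup.DirectLimit.of.zero_exact (f := κ.restr M) i f h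
  ext a
  refine κ.quot_eq_zero (κ.colon_mem_filter j.mem (a : R)) fun b hb => ?_
  rw [← map_smul]
  exact LinearMap.congr_fun hj ⟨b * (a : R), hb⟩

/-- If `f` is defined on `I`, then `r • f` is the map `a ↦ f (a * r)`, defined on `(I : r)`. -/
def smulHom (r : R) (i : κ.Idx) :
    κ.HomAt M i →+ κ.HomAt M (κ.idx (κ.colon_mem_filter i.mem r)) where
  toFun f :=
    { toFun := fun a => f ⟨(a : R) * r, a.2⟩
      map_add' := fun a b => by
        rw [← map_add]; congr 1; ext; simp [add_mul]
      map_smul' := fun c a => by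
        rw [RingHom.id_apply, ← map_smul]; congr 1; ext; simp [mul_assoc] }
  map_zero' := rfl
  map_add' _ _ := rfl

open Classical in
/-- Multiplication by `r` on `Q_κ(M)`. -/
def smulAdd (r : R) : κ.Loc M →+ κ.Loc M :=
  AddCommGroup.DirectLimit.lift (κ.HomAt M) (κ.restr M) (κ.Loc M)
    (fun i => (of _).comp (smulHom r i)) (fun i j hij f => by
      exact of_restr (M := M) (i := κ.idx (κ.colon_mem_filter i.mem r))
        (j := κ.idx (κ.colon_mem_filter j.mem r))
        (show colon j.ideal r ≤ colon i.ideal r from fun a ha => hij ha) (smulHom r i f))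

instance : SMul R (κ.Loc M) := ⟨fun r => smulAdd r⟩

theorem smul_of (r : R) (i : κ.Idx) (f : κ.HomAt M i) :
    r • of i f = of _ (smulHom r i f) := by
  classical
  exact AddCommGroup.DirectLimit.lift_of (f := κ.restr M) (κ.Loc M) _ _ i f

theorem of_eq_of {i j : κ.Idx} {f : κ.HomAt M i} {g : κ.HomAt M j}
    (h : ∀ (a : R) (hi : a ∈ i.ideal) (hj : a ∈ j.ideal), f ⟨a, hi⟩ = g ⟨a, hj⟩) :
    of i f = of j g := by
  obtain ⟨k, hik, hjk⟩ := exists_ge_ge i j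
  rw [← of_restr hik, ← of_restr hjk]
  congr 1
  ext a
  exact h _ _ _

instance : Module R (κ.Loc M) where
  one_smul q := by
    obtain ⟨i, f, rfl⟩ := exists_of q
    rw [smul_of]
    exact of_eq_of fun a h1 h2 => congrArg f (Subtype.ext (mul_one a))
  mul_smul r s q := by
    obtain ⟨i, f, rfl⟩ := exists_of q
    rw [smul_of, smul_of, smul_of]
    exact of_eq_of fun a h1 h2 => congrArg f (Subtype.ext (mul_assoc a r s).symm)
  smul_zero r := map_zero (smulAdd r)
  smul_add r := map_add (smulAdd r)
  zero_smul q := by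
    obtain ⟨i, f, rfl⟩ := exists_of q
    rw [smul_of, of_eq_zero]
    ext a
    exact (congrArg f (Subtype.ext (mul_zero (a : R)))).trans (map_zero f)
  add_smul r s q := by
    obtain ⟨i, f, rfl⟩ := exists_of q
    rw [smul_of, smul_of, smul_of]
    obtain ⟨k, h1, h2⟩ := exists_ge_ge (κ.idx (κ.colon_mem_filter i.mem r))
      (κ.idx (κ.colon_mem_filter i.mem s))
    rw [← of_restr h1, ← of_restr h2, ← map_add]
    refine of_eq_of fun a ha hb => ?_
    have h3 : a * r ∈ i.ideal := h1 hb
    have h4 : a * s ∈ i.ideal := h2 hb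
    have h5 : a * (r + s) ∈ i.ideal := ha
    have h6 : (⟨a * (r + s), h5⟩ : i.ideal) = ⟨a * r, h3⟩ + ⟨a * s, h4⟩ :=
      Subtype.ext (mul_add a r s)
    exact (congrArg f h6).trans (map_add f _ _)

/-- The map `M / κ(M) → Q_κ(M)` sending `x` to the class of `R → M / κ(M)`, `a ↦ a • x`. -/
def jBar : (M ⧸ κ.obj M) →ₗ[R] κ.Loc M where
  toFun x := of (κ.idx κ.top_mem_filter)
    ((LinearMap.toSpanSingleton R (M ⧸ κ.obj M) x).comp (Submodule.subtype ⊤))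
  map_add' x y := by
    rw [← map_add]; congr 1; ext a; exact smul_add (a : R) x y
  map_smul' r x := by
    rw [RingHom.id_apply, smul_of]
    exact of_eq_of fun a _ _ => (mul_smul a r x).symm

/-- The localization morphism `j_κ : M → Q_κ(M)`. -/
def j : M →ₗ[R] κ.Loc M := jBar.comp (κ.obj M).mkQ

theorem jBar_injective : Function.Injective (jBar : (M ⧸ κ.obj M) →ₗ[R] κ.Loc M) := by
  rw [injective_iff_map_eq_zero]
  intro x hx
  have := LinearMap.congr_fun (of_eq_zero.1 hx) ⟨1, trivial⟩
  exact (one_smul R x).symm.trans this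

theorem smul_of_mem {i : κ.Idx} (f : κ.HomAt M i) {a : R} (ha : a ∈ i.ideal) :
    a • of i f = jBar (f ⟨a, ha⟩) := by
  rw [smul_of]
  refine of_eq_of fun b h1 h2 => ?_
  exact map_smul f b ⟨a, ha⟩

theorem ker_j : LinearMap.ker (j : M →ₗ[R] κ.Loc M) = κ.obj M := by
  ext x
  have : (j x : κ.Loc M) = 0 ↔ (κ.obj M).mkQ x = 0 := by
    rw [← (jBar_injective (κ := κ) (M := M)).eq_iff, map_zero]; rfl
  rw [LinearMap.mem_ker, this]
  simp

theorem range_j : LinearMap.range (j : M →ₗ[R] κ.Loc M) = LinearMap.range jBar :=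
  LinearMap.range_comp_of_range_eq_top _ (Submodule.range_mkQ _)

/-- `Q_κ(M)` is `κ`-torsion free. -/
theorem eq_zero_of_smul {I : Submodule R R} (hI : I ∈ κ.filter) {q : κ.Loc M}
    (h : ∀ a ∈ I, a • q = 0) : q = 0 := by
  obtain ⟨i, f, rfl⟩ := exists_of q
  rw [of_eq_zero]
  ext a
  refine κ.quot_eq_zero (κ.colon_mem_filter hI (a : R)) fun b hb => ?_
  have := h (b * (a : R)) hb
  rw [mul_smul, smul_of_mem f a.2, ← map_smul] at this
  exact jBar_injective (this.trans (map_zero _).symm)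

/-- `Q_κ(M) / j_κ(M)` is `κ`-torsion. -/
theorem colon_range_mem (q : κ.Loc M) : colon (LinearMap.range j) q ∈ κ.filter := by
  obtain ⟨i, f, rfl⟩ := exists_of q
  refine κ.filter_mono (fun a ha => ?_) i.mem
  rw [mem_colon, smul_of_mem f ha, range_j]
  exact LinearMap.mem_range_self _ _

/-- Every homomorphism from a member of `𝓛(κ)` to `Q_κ(M)` is given by an element of `Q_κ(M)`. -/
theorem exists_smul_eq {K : Submodule R R} (hK : K ∈ κ.filter) (g : K →ₗ[R] κ.Loc M) :
    ∃ q : κ.Loc M, ∀ a : K, (a : R) • q = g a := by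
  have hK' : ((LinearMap.range (jBar : (M ⧸ κ.obj M) →ₗ[R] κ.Loc M)).comap g).map K.subtype
      ∈ κ.filter := by
    refine κ.mem_filter_of_colon hK fun a ha => ?_
    refine κ.filter_mono (fun b hb => ?_) (colon_range_mem (g ⟨a, ha⟩))
    refine ⟨b • ⟨a, ha⟩, ?_, rfl⟩
    rw [mem_colon, range_j] at hb
    change g (b • ⟨a, ha⟩) ∈ LinearMap.range (jBar : (M ⧸ κ.obj M) →ₗ[R] κ.Loc M)
    rwa [map_smul]
  have hle : (κ.idx hK').ideal ≤ K := Submodule.map_subtype_le _ _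
  have hmem : ∀ a : (κ.idx hK').ideal, g (Submodule.inclusion hle a) ∈
      LinearMap.range (jBar : (M ⧸ κ.obj M) →ₗ[R] κ.Loc M) := by
    rintro ⟨a, b, hb, rfl⟩
    exact hb
  refine ⟨of (κ.idx hK') ((LinearEquiv.ofInjective jBar jBar_injective).symm.toLinearMap.comp
    ((g.comp (Submodule.inclusion hle)).codRestrict _ hmem)), fun a => ?_⟩
  have key : ∀ (b : R) (hb : b ∈ (κ.idx hK').ideal), b • of (κ.idx hK')
      ((LinearEquiv.ofInjective jBar jBar_injective).symm.toLinearMap.comp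
        ((g.comp (Submodule.inclusion hle)).codRestrict _ hmem)) = g ⟨b, hle hb⟩ := by
    intro b hb
    rw [smul_of_mem _ hb]
    have := LinearEquiv.apply_symm_apply (LinearEquiv.ofInjective
      (jBar : (M ⧸ κ.obj M) →ₗ[R] κ.Loc M) jBar_injective)
      ((g.comp (Submodule.inclusion hle)).codRestrict _ hmem ⟨b, hb⟩)
    exact congrArg Subtype.val this
  rw [← sub_eq_zero]
  refine eq_zero_of_smul (κ.colon_mem_filter hK' (a : R)) fun b hb => ?_
  rw [smul_sub, ← mul_smul, ← map_smul g, sub_eq_zero]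
  exact key (b * (a : R)) hb

/-! ### The ring `Q_κ(R)` and the `Q_κ(R)`-module `Q_κ(M)` -/

theorem smul_eq_zero_of_j_eq_zero {b : R} (hb : (j b : κ.Loc R) = 0) (y : κ.Loc M) :
    b • y = 0 := by
  have : b ∈ κ.obj R := by rw [← ker_j]; exact hb
  obtain ⟨I, hI, h⟩ := κ.mem_obj_iff.1 this
  refine eq_zero_of_smul hI fun a ha => ?_
  rw [← mul_smul, ← smul_eq_mul, h a ha, zero_smul]

theorem smul_eq_smul_of_j_eq {b c : R} (h : (j b : κ.Loc R) = j c) (y : κ.Loc M) :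
    b • y = c • y := by
  rw [← sub_eq_zero, ← sub_smul]
  exact smul_eq_zero_of_j_eq_zero (by rw [map_sub, h, sub_self]) y

/-- Two elements are equal if they have the same multiples by sufficiently many ring elements. -/
theorem eq_of_smul {K : Submodule R R} (hK : K ∈ κ.filter) {y z : κ.Loc M}
    (h : ∀ a ∈ K, a • y = a • z) : y = z := by
  rw [← sub_eq_zero]
  exact eq_zero_of_smul hK fun a ha => by rw [smul_sub, h a ha, sub_self]

theorem exists_mul (x : κ.Loc R) (y : κ.Loc M) :
    ∃ z : κ.Loc M, ∀ a b : R, a • x = j b → a • z = b • y := by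
  have hex : ∀ a : colon (LinearMap.range (j : R →ₗ[R] κ.Loc R)) x,
      ∃ b : R, j b = (a : R) • x := fun a => a.2
  choose b hb using hex
  obtain ⟨z, hz⟩ := exists_smul_eq (M := M) (colon_range_mem x)
    { toFun := fun a => b a • y
      map_add' := fun a a' => by
        rw [← add_smul]
        refine smul_eq_smul_of_j_eq ?_ y
        rw [hb, map_add, hb, hb]; exact add_smul _ _ _
      map_smul' := fun r a => by
        rw [RingHom.id_apply, ← mul_smul]
        refine smul_eq_smul_of_j_eq ?_ y
        rw [hb, ← smul_eq_mul, map_smul, hb]; exact mul_smul _ _ _ }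
  refine ⟨z, fun a c hc => ?_⟩
  have := hz ⟨a, c, hc.symm⟩
  refine this.trans (smul_eq_smul_of_j_eq ?_ y)
  exact (hb _).trans hc

/-- The product `x y ∈ Q_κ(M)` of `x ∈ Q_κ(R)` and `y ∈ Q_κ(M)`: the unique element such that
`a (x y) = b y` whenever `a x = j_κ(b)` with `a, b ∈ R`. -/
def mul (x : κ.Loc R) (y : κ.Loc M) : κ.Loc M := Classical.choose (exists_mul x y)

theorem smul_mul_of_eq {x : κ.Loc R} {a b : R} (h : a • x = j b) (y : κ.Loc M) :
    a • mul x y = b • y :=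
  Classical.choose_spec (exists_mul x y) a b h

theorem eq_mul {K : Submodule R R} (hK : K ∈ κ.filter) {x : κ.Loc R} {y z : κ.Loc M}
    (h : ∀ a ∈ K, ∀ b, a • x = j b → a • z = b • y) : z = mul x y := by
  refine eq_of_smul (κ.inf_mem_filter hK (colon_range_mem x)) fun a ha => ?_
  obtain ⟨b, hb⟩ : ∃ b : R, j b = a • x := ha.2
  rw [h a ha.1 b hb.symm, smul_mul_of_eq hb.symm]

theorem j_mul (r : R) (y : κ.Loc M) : mul (j r) y = r • y := by
  refine (eq_mul κ.top_mem_filter fun a _ b hb => ?_).symm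
  rw [← map_smul] at hb
  rw [← mul_smul]
  exact smul_eq_smul_of_j_eq hb y

theorem mul_add' (x : κ.Loc R) (y z : κ.Loc M) : mul x (y + z) = mul x y + mul x z := by
  refine (eq_mul κ.top_mem_filter fun a _ b hb => ?_).symm
  rw [smul_add, smul_mul_of_eq hb, smul_mul_of_eq hb, smul_add]

theorem add_mul' (x x' : κ.Loc R) (y : κ.Loc M) : mul (x + x') y = mul x y + mul x' y := by
  refine (eq_mul (colon_range_mem x) fun a ha b hb => ?_).symm
  obtain ⟨c, hc⟩ : ∃ c : R, j c = a • x := ha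
  have h2 : a • x' = j (b - c) := by
    rw [map_sub, ← hb, hc, smul_add]
    exact (add_sub_cancel_left (a • x) (a • x')).symm
  rw [smul_add, smul_mul_of_eq hc.symm, smul_mul_of_eq h2, ← add_smul, add_sub_cancel]

theorem smul_mul' (r : R) (x : κ.Loc R) (y : κ.Loc M) : mul (r • x) y = r • mul x y := by
  refine (eq_mul κ.top_mem_filter fun a _ b hb => ?_).symm
  rw [← mul_smul] at hb ⊢
  exact smul_mul_of_eq hb y

theorem mul_assoc' (x x' : κ.Loc R) (y : κ.Loc M) : mul (mul x x') y = mul x (mul x' y) := by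
  refine (eq_mul κ.top_mem_filter fun a _ b hb => ?_)
  rw [← smul_mul', smul_mul_of_eq hb, smul_mul']

theorem one_mul' (y : κ.Loc M) : mul (j 1) y = y := by rw [j_mul, one_smul]

theorem mul_one' (x : κ.Loc R) : mul x (j 1) = x := by
  refine (eq_mul κ.top_mem_filter fun a _ b hb => ?_).symm
  rw [hb, ← map_smul, smul_eq_mul, mul_one]

theorem zero_mul' (y : κ.Loc M) : mul (0 : κ.Loc R) y = 0 := by
  simpa using add_mul' (0 : κ.Loc R) 0 y

theorem mul_zero' (x : κ.Loc R) : mul x (0 : κ.Loc M) = 0 := by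
  simpa using mul_add' x (0 : κ.Loc M) 0

/-- The ring structure of `Q_κ(R)`. -/
instance : Ring (κ.Loc R) :=
  { (inferInstance : AddCommGroup (κ.Loc R)) with
    mul := mul
    one := j 1
    left_distrib := mul_add'
    right_distrib := add_mul'
    zero_mul := zero_mul'
    mul_zero := mul_zero'
    mul_assoc := mul_assoc'
    one_mul := one_mul'
    mul_one := mul_one' }

/-- The `Q_κ(R)`-module structure of `Q_κ(M)`. -/
instance : Module (κ.Loc R) (κ.Loc M) where
  smul := mul
  one_smul := one_mul'
  mul_smul := mul_assoc'
  smul_zero := mul_zero'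
  smul_add := mul_add'
  zero_smul := zero_mul'
  add_smul := add_mul'

/-- The `Q_κ(R)`-module structure of `Q_κ(M)` extends its `R`-module structure. -/
instance : IsScalarTower R (κ.Loc R) (κ.Loc M) := ⟨smul_mul'⟩

variable (κ) in
/-- The localization morphism `j_κ : R → Q_κ(R)`, as a ring homomorphism. -/
def jRing : R →+* κ.Loc R :=
  { (j : R →ₗ[R] κ.Loc R).toAddMonoidHom with
    map_one' := rfl
    map_mul' := fun a b => by
      change j (a * b) = mul (j a) (j b)
      rw [j_mul, ← map_smul, smul_eq_mul] }

/-- The quotient filtration on `Q_κ(M)`: `F_γ Q_κ(M)` consists of the `q` for which there is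
`I ∈ 𝓛(κ)` with `(F_n I) q ⊆ j_κ(F_{n+γ} M)` for all `n`, where `F_n I = I ∩ F_n R`. -/
def filtration (FR : ℤ → AddSubgroup R) (FM : ℤ → AddSubgroup M) (γ : ℤ) :
    AddSubgroup (κ.Loc M) where
  carrier := {q | ∃ I ∈ κ.filter, ∀ n : ℤ, ∀ a ∈ I, a ∈ FR n →
    a • q ∈ (FM (n + γ)).map (j : M →ₗ[R] κ.Loc M).toAddMonoidHom}
  zero_mem' := ⟨⊤, κ.top_mem_filter, fun n a _ _ => by
    rw [smul_zero]; exact AddSubgroup.zero_mem _⟩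
  add_mem' := by
    rintro p q ⟨I, hI, h⟩ ⟨J, hJ, h'⟩
    refine ⟨I ⊓ J, κ.inf_mem_filter hI hJ, fun n a ha hn => ?_⟩
    rw [smul_add]
    exact AddSubgroup.add_mem _ (h n a ha.1 hn) (h' n a ha.2 hn)
  neg_mem' := by
    rintro q ⟨I, hI, h⟩
    refine ⟨I, hI, fun n a ha hn => ?_⟩
    rw [smul_neg]
    exact AddSubgroup.neg_mem _ (h n a ha hn)

end

end Loc

end KernelFunctor

/-!
The quotient filtration on `Q_κ(M)` is controlled by one finiteness property. Since the Rees ring is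
left Noetherian, every left ideal `I` of `R` has finitely many elements `a_i ∈ F_{d_i} R` with
`F_n I = ∑ (F_{n - d_i} R) a_i` for all `n` (`IsFilteredRing.exists_goodGenerators`); they are the
homogeneous components of generators of the Rees module of `I`.

This property is used twice. First, if `I ∈ 𝓛(κ)` and `I q ⊆ j_κ(M)`, it is enough to bound the
degrees of the finitely many `a_i q`, so the quotient filtration is exhaustive. Secondly, it shows
that every left ideal is closed: the closure `N` of `I` satisfies `N ⊆ I + ∑ (F_{-1} R) a_i`, where
the `a_i` generate `N`, and as `F_{-1} R` lies in the Jacobson radical of `F_0 R`, Nakayama's lemma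
over `F_0 R` gives `N = I`. Applied to `I = κ(R)`, this says that the filtration of `R / κ(R)` is
separated.

Strictness of `j_κ` is where `κ`-separatedness enters: if `j_κ(m) ∈ F_n Q_κ(M)` while the class of
`m` has degree `p > n`, then some `I ∈ 𝓛(κ)` lowers that degree, so the class of `m` is torsion in
`M / κ(M)` and hence zero. Separatedness of `F Q_κ(M)` follows from strictness, and so does its
compatibility with the product: if `a x = j_κ(b)` with `b` of the right degree, then `a (x y) = b y`
lies in the right term of `F Q_κ(M)`, and it lies in `j_κ(M)` for all `a` in a member of `𝓛(κ)`.
-/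

/-! ### Good filtrations on left ideals -/

namespace IsFilteredRing

variable {R : Type u} [Ring R] {FR : ℤ → AddSubgroup R}

/-- The left ideal of the Rees ring consisting of the Laurent polynomials `∑ (F_n R ∩ I) T ^ n`. -/
def reesIdeal (h : IsFilteredRing FR) (I : Submodule R R) : Submodule h.reesRing h.reesRing where
  carrier := {f | ∀ n : ℤ, f.1.coeff n ∈ I}
  add_mem' {f g} hf hg n := I.add_mem (hf n) (hg n)
  zero_mem' n := I.zero_mem
  smul_mem' r f hf n := by
    classical
    change (r.1 * f.1).coeff n ∈ I
    rw [AddMonoidAlgebra.coeff_mul]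
    refine I.sum_mem fun i _ => I.sum_mem fun j _ => ?_
    change (if i + j = n then r.1.coeff i * f.1.coeff j else 0) ∈ I
    split_ifs
    · exact I.smul_mem _ (hf j)
    · exact I.zero_mem

/-- The additive subgroup `∑ (F_{n - d} R) a`, the sum being over all `(d, a) ∈ T`. -/
def goodSpan (FR : ℤ → AddSubgroup R) (T : Set (ℤ × R)) (n : ℤ) : AddSubgroup R :=
  AddSubgroup.closure {x | ∃ t ∈ T, ∃ c ∈ FR (n - t.1), x = c * t.2}

theorem mul_mem_goodSpan (h : IsFilteredRing FR) {T : Set (ℤ × R)} {m n : ℤ} {r x : R}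
    (hr : r ∈ FR m) (hx : x ∈ goodSpan FR T n) : r * x ∈ goodSpan FR T (m + n) := by
  have hle : goodSpan FR T n ≤ (goodSpan FR T (m + n)).comap (AddMonoidHom.mulLeft r) := by
    refine (AddSubgroup.closure_le _).2 ?_
    rintro _ ⟨t, ht, c, hc, rfl⟩
    refine AddSubgroup.subset_closure ⟨t, ht, r * c, ?_, (mul_assoc _ _ _).symm⟩
    have := h.mul_mem hr hc
    rwa [← add_sub_assoc] at this
  exact hle hx

/-- If the Rees ring is left Noetherian, then the filtration induced on a left ideal is good: there
are finitely many `a_i ∈ F_{d_i} I` with `F_n I = ∑ (F_{n - d_i} R) a_i` for all `n`. -/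
theorem exists_goodGenerators (h : IsFilteredRing FR) (hN : IsNoetherianRing h.reesRing)
    (I : Submodule R R) :
    ∃ T : Set (ℤ × R), T.Finite ∧ (∀ t ∈ T, t.2 ∈ I ∧ t.2 ∈ FR t.1) ∧
      ∀ (n : ℤ) (x : R), x ∈ I → x ∈ FR n → x ∈ goodSpan FR T n := by
  classical
  obtain ⟨S, hS⟩ := hN.noetherian (h.reesIdeal I)
  have hSI : ∀ f ∈ S, ∀ n, f.1.coeff n ∈ I := fun f hf =>
    show f ∈ h.reesIdeal I from hS ▸ Submodule.subset_span hf
  let T : Finset (ℤ × R) := S.biUnion fun f => f.1.coeff.support.image fun n => (n, f.1.coeff n)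
  refine ⟨T, T.finite_toSet, ?_, ?_⟩
  · intro t ht
    simp only [T, Finset.coe_biUnion, Finset.coe_image, Set.mem_iUnion, Set.mem_image] at ht
    obtain ⟨f, hf, n, -, rfl⟩ := ht
    exact ⟨hSI f hf n, f.2 n⟩
  · have key : ∀ f ∈ h.reesIdeal I, ∀ n, f.1.coeff n ∈ goodSpan FR (T : Set (ℤ × R)) n := by
      rw [← hS]
      intro f hf
      induction hf using Submodule.span_induction with
      | mem f hf =>
        intro n
        by_cases hn : f.1.coeff n = 0
        · rw [hn]; exact AddSubgroup.zero_mem _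
        · refine AddSubgroup.subset_closure ⟨(n, f.1.coeff n), ?_, 1, ?_, (one_mul _).symm⟩
          · exact Finset.mem_coe.2 (Finset.mem_biUnion.2
              ⟨f, hf, Finset.mem_image.2 ⟨n, Finsupp.mem_support_iff.2 hn, rfl⟩⟩)
          · simpa using h.one_mem
      | zero => exact fun n => AddSubgroup.zero_mem _
      | add f g _ _ hf hg => exact fun n => AddSubgroup.add_mem _ (hf n) (hg n)
      | smul r f _ hf =>
        intro n
        change (r.1 * f.1).coeff n ∈ _
        rw [AddMonoidAlgebra.coeff_mul]
        refine AddSubgroup.sum_mem _ fun i _ => AddSubgroup.sum_mem _ fun j _ => ?_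
        change (if i + j = n then r.1.coeff i * f.1.coeff j else 0) ∈ _
        split_ifs with hij
        · exact hij ▸ h.mul_mem_goodSpan (r.2 i) (hf j)
        · exact AddSubgroup.zero_mem _
    intro n x hxI hxn
    have hcoeff : ∀ m, (AddMonoidAlgebra.single n x : LaurentPolynomial R).coeff m =
        if n = m then x else 0 := fun m => Finsupp.single_apply
    have hmem : (AddMonoidAlgebra.single n x : LaurentPolynomial R) ∈ h.reesRing := fun m => by
      rw [hcoeff]
      split_ifs with hm
      · exact hm ▸ hxn
      · exact AddSubgroup.zero_mem _
    have := key ⟨_, hmem⟩ (fun m => by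
      change (AddMonoidAlgebra.single n x : LaurentPolynomial R).coeff m ∈ I
      rw [hcoeff]
      split_ifs
      · exact hxI
      · exact I.zero_mem) n
    change (AddMonoidAlgebra.single n x : LaurentPolynomial R).coeff n ∈ _ at this
    rwa [hcoeff, if_pos rfl] at this

/-- The closure `⋂ (I + F_n R)` of a left ideal `I` in the topology defined by the filtration. -/
def idealClosure (h : IsFilteredRing FR) (I : Submodule R R) : Submodule R R where
  carrier := {x | ∀ n : ℤ, ∃ y ∈ I, x - y ∈ FR n}
  add_mem' {a b} ha hb n := by
    obtain ⟨y, hy, hay⟩ := ha n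
    obtain ⟨z, hz, hbz⟩ := hb n
    exact ⟨y + z, I.add_mem hy hz, by
      rw [add_sub_add_comm]; exact (FR n).add_mem hay hbz⟩
  zero_mem' n := ⟨0, I.zero_mem, by rw [sub_zero]; exact (FR n).zero_mem⟩
  smul_mem' c a ha n := by
    obtain ⟨m, hc⟩ := h.exhaustive c
    obtain ⟨y, hy, hay⟩ := ha (n - m)
    refine ⟨c • y, I.smul_mem c hy, ?_⟩
    have := h.mul_mem hc hay
    rwa [add_sub_cancel, mul_sub] at this

/-- For a Zariskian filtration, every left ideal is closed. -/
theorem idealClosure_eq (h : IsFilteredRing FR) (hZ : h.IsZariskian) (I : Submodule R R) :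
    h.idealClosure I = I := by
  have hle : I ≤ h.idealClosure I := fun x hx n =>
    ⟨x, hx, by rw [sub_self]; exact (FR n).zero_mem⟩
  refine le_antisymm ?_ hle
  obtain ⟨T, hT, hTI, hgen⟩ := h.exists_goodGenerators hZ.noetherian (h.idealClosure I)
  obtain ⟨n, hn⟩ : ∃ n : ℤ, ∀ t ∈ T, n - t.1 ≤ -1 := by
    obtain ⟨n, hn⟩ := (hT.image Prod.fst).bddBelow
    exact ⟨n - 1, fun t ht => by have := hn (Set.mem_image_of_mem _ ht); omega⟩
  -- The submodule over `F_0 R` of `R ⧸ I` to which Nakayama's lemma is applied.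
  let N : Submodule h.zeroSubring (R ⧸ I) := Submodule.span _ ((fun t => I.mkQ t.2) '' T)
  have hN : N = ⊥ := by
    refine Submodule.FG.eq_bot_of_le_jacobson_smul
      (Submodule.fg_span (hT.image _)) (Submodule.span_le.2 ?_)
    rintro _ ⟨t, ht, rfl⟩
    obtain ⟨y, hy, hty⟩ := (hTI t ht).1 n
    have hmem := hgen n _ (Submodule.sub_mem _ (hTI t ht).1 (hle hy)) hty
    have hsub : goodSpan FR T n ≤
        (Ring.jacobson h.zeroSubring • N).toAddSubgroup.comap I.mkQ.toAddMonoidHom := by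
      refine (AddSubgroup.closure_le _).2 ?_
      rintro _ ⟨s, hs, c, hc, rfl⟩
      have hc' : c ∈ FR (-1) := h.mono (hn s hs) hc
      have hc0 : c ∈ h.zeroSubring := h.mono (by norm_num : (-1 : ℤ) ≤ 0) hc'
      have : (⟨c, hc0⟩ : h.zeroSubring) • I.mkQ s.2 ∈ Ring.jacobson h.zeroSubring • N :=
        Submodule.smul_mem_smul (hZ.le_jacobson _ hc')
          (Submodule.subset_span (Set.mem_image_of_mem _ hs))
      exact this
    have := hsub hmem
    change I.mkQ (t.2 - y) ∈ Ring.jacobson h.zeroSubring • N at this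
    rwa [map_sub, show I.mkQ y = 0 from (Submodule.Quotient.mk_eq_zero _).2 hy, sub_zero] at this
  have hTmem : ∀ t ∈ T, t.2 ∈ I := fun t ht => by
    have : I.mkQ t.2 ∈ N := Submodule.subset_span (Set.mem_image_of_mem _ ht)
    rw [hN, Submodule.mem_bot] at this
    exact (Submodule.Quotient.mk_eq_zero _).1 this
  intro x hx
  obtain ⟨m, hm⟩ := h.exhaustive x
  have hsub : goodSpan FR T m ≤ I.toAddSubgroup := by
    refine (AddSubgroup.closure_le _).2 ?_
    rintro _ ⟨s, hs, c, -, rfl⟩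
    exact I.smul_mem c (hTmem s hs)
  exact hsub (hgen m x hx hm)

theorem isSeparatedFiltration_quotFiltration (h : IsFilteredRing FR) (hZ : h.IsZariskian)
    (I : Submodule R R) : IsSeparatedFiltration (quotFiltration FR I) := by
  refine (AddSubgroup.eq_bot_iff_forall _).2 fun x hx => ?_
  obtain ⟨a, rfl⟩ := I.mkQ_surjective x
  rw [AddSubgroup.mem_iInf] at hx
  refine (Submodule.Quotient.mk_eq_zero _).2 ?_
  rw [← h.idealClosure_eq hZ I]
  intro n
  obtain ⟨b, hb, hba⟩ := hx n
  refine ⟨a - b, (Submodule.Quotient.eq I).1 hba.symm, ?_⟩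
  rwa [sub_sub_cancel]

theorem isFilteredModule (h : IsFilteredRing FR) : IsFilteredModule FR FR where
  mono := h.mono
  smul_mem := h.mul_mem
  exhaustive := h.exhaustive

end IsFilteredRing

/-! ### The quotient filtration -/

namespace KernelFunctor.Loc

variable {R : Type u} [Ring R] {κ : KernelFunctor R} {M : Type u} [AddCommGroup M] [Module R M]
  {FR : ℤ → AddSubgroup R} {FM : ℤ → AddSubgroup M}

theorem j_mem_map_iff {n : ℤ} {m : M} :
    (j m : κ.Loc M) ∈ (FM n).map (j : M →ₗ[R] κ.Loc M).toAddMonoidHom ↔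
      (κ.obj M).mkQ m ∈ quotFiltration FM (κ.obj M) n := by
  constructor
  · rintro ⟨x, hx, hxm⟩
    exact ⟨x, hx, jBar_injective hxm⟩
  · rintro ⟨x, hx, hxm⟩
    exact ⟨x, hx, congrArg jBar hxm⟩

theorem filtration_mono (hM : Monotone FM) : Monotone (filtration (κ := κ) FR FM) := by
  rintro p q hpq x ⟨I, hI, h⟩
  exact ⟨I, hI, fun n a ha hn =>
    AddSubgroup.map_mono (hM (add_le_add_right hpq n)) (h n a ha hn)⟩

theorem j_mem_filtration (hM : IsFilteredModule FR FM) {n : ℤ} {m : M} (hm : m ∈ FM n) :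
    (j m : κ.Loc M) ∈ filtration FR FM n :=
  ⟨⊤, κ.top_mem_filter, fun _ a _ ha => ⟨a • m, hM.smul_mem ha hm, map_smul j a m⟩⟩

theorem smul_mem_filtration (hR : IsFilteredRing FR) {m n : ℤ} {r : R}
    {q : κ.Loc M} (hr : r ∈ FR m) (hq : q ∈ filtration FR FM n) :
    r • q ∈ filtration FR FM (m + n) := by
  obtain ⟨I, hI, h⟩ := hq
  refine ⟨_, κ.colon_mem_filter hI r, fun k a ha hk => ?_⟩
  rw [← mul_smul, ← add_assoc]
  exact h (k + m) (a * r) ha (hR.mul_mem hk hr)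

theorem exists_mem_filtration (hR : IsFilteredRing FR) (hN : IsNoetherianRing hR.reesRing)
    (hM : IsFilteredModule FR FM) (q : κ.Loc M) : ∃ γ : ℤ, q ∈ filtration FR FM γ := by
  obtain ⟨T, hT, hTI, hgen⟩ := hR.exists_goodGenerators hN (colon (LinearMap.range j) q)
  have hdeg : ∀ t ∈ T, ∃ m : M, j m = t.2 • q ∧ ∃ γ : ℤ, m ∈ FM γ := fun t ht => by
    obtain ⟨m, hm⟩ := (hTI t ht).1
    exact ⟨m, hm, hM.exhaustive m⟩
  choose! m hm e he using hdeg
  obtain ⟨γ, hγ⟩ : ∃ γ : ℤ, ∀ t ∈ T, e t - t.1 ≤ γ := by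
    obtain ⟨γ, hγ⟩ := (hT.image fun t => e t - t.1).bddAbove
    exact ⟨γ, fun t ht => hγ (Set.mem_image_of_mem _ ht)⟩
  refine ⟨γ, _, colon_range_mem q, fun n a ha hn => ?_⟩
  have hsub : IsFilteredRing.goodSpan FR T n ≤
      ((FM (n + γ)).map (j : M →ₗ[R] κ.Loc M).toAddMonoidHom).comap
        (LinearMap.toSpanSingleton R (κ.Loc M) q).toAddMonoidHom := by
    refine (AddSubgroup.closure_le _).2 ?_
    rintro _ ⟨t, ht, c, hc, rfl⟩
    refine ⟨c • m t, hM.mono ?_ (hM.smul_mem hc (he t ht)), ?_⟩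
    · have := hγ t ht
      omega
    · change j (c • m t) = (c * t.2) • q
      rw [map_smul, hm t ht, mul_smul]
  exact hsub (hgen n a ha hn)

/-- If `M / κ(M)` is `κ`-separated, then `F_n Q_κ(M) ∩ j_κ(M) ⊆ j_κ(F_n M)`. -/
theorem j_mem_map_of_mem_filtration (hM : IsFilteredModule FR FM)
    (hsep : κ.IsSeparated FR (quotFiltration FM (κ.obj M))) {n : ℤ} {m : M}
    (h : (j m : κ.Loc M) ∈ filtration FR FM n) :
    (j m : κ.Loc M) ∈ (FM n).map (j : M →ₗ[R] κ.Loc M).toAddMonoidHom := by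
  rw [j_mem_map_iff]
  by_contra hn
  have hmono : Monotone (quotFiltration FM (κ.obj M)) := fun p q hpq =>
    AddSubgroup.map_mono (hM.mono hpq)
  -- The degree of the class of `m`; it exists because the class does not lie in `F_n`.
  obtain ⟨p, hp, hpmin⟩ := Int.exists_least_of_bdd
    (P := fun p => (κ.obj M).mkQ m ∈ quotFiltration FM (κ.obj M) p)
    ⟨n, fun z hz => le_of_not_gt fun hlt => hn (hmono hlt.le hz)⟩
    ((hM.exhaustive m).imp fun p hp => ⟨m, hp, rfl⟩)
  have hnp : n ≤ p - 1 := by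
    by_contra hlt
    exact hn (hmono (by omega) hp)
  obtain ⟨I, hI, hIm⟩ := h
  have htors : (κ.obj M).mkQ m ∈ κ.obj (M ⧸ κ.obj M) := by
    refine hsep p _ hp (fun hp' => ?_) ⟨I, hI, fun γ a ha hγ => ?_⟩
    · have := hpmin _ hp'
      omega
    · have := hIm γ a ha hγ
      rw [← map_smul, j_mem_map_iff, map_smul] at this
      exact hmono (by omega) this
  rw [κ.radical, Submodule.mem_bot] at htors
  rw [htors] at hn
  exact hn (AddSubgroup.zero_mem _)

theorem isStrictFilteredHom_j (hM : IsFilteredModule FR FM)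
    (hsep : κ.IsSeparated FR (quotFiltration FM (κ.obj M))) :
    IsStrictFilteredHom FM (filtration (κ := κ) FR FM)
      (j : M →ₗ[R] κ.Loc M).toAddMonoidHom := by
  intro n
  ext q
  constructor
  · rintro ⟨m, hm, rfl⟩
    exact ⟨j_mem_filtration hM hm, m, rfl⟩
  · rintro ⟨hq, m, rfl⟩
    exact j_mem_map_of_mem_filtration hM hsep hq

theorem isSeparatedFiltration_filtration (hR : IsFilteredRing FR) (hM : IsFilteredModule FR FM)
    (hsep : κ.IsSeparated FR (quotFiltration FM (κ.obj M)))
    (hzero : IsSeparatedFiltration (quotFiltration FM (κ.obj M))) :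
    IsSeparatedFiltration (filtration (κ := κ) FR FM) := by
  refine (AddSubgroup.eq_bot_iff_forall _).2 fun q hq => ?_
  rw [AddSubgroup.mem_iInf] at hq
  refine eq_zero_of_smul (colon_range_mem q) fun a ha => ?_
  obtain ⟨m, hm⟩ : ∃ m : M, j m = a • q := ha
  obtain ⟨p, hp⟩ := hR.exhaustive a
  have hmem : (κ.obj M).mkQ m ∈ ⨅ n, quotFiltration FM (κ.obj M) n := by
    rw [AddSubgroup.mem_iInf]
    intro n
    rw [← j_mem_map_iff]
    refine j_mem_map_of_mem_filtration hM hsep ?_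
    have := smul_mem_filtration hR hp (hq (n - p))
    rwa [add_sub_cancel, ← hm] at this
  rw [show (⨅ n, quotFiltration FM (κ.obj M) n) = ⊥ from hzero, AddSubgroup.mem_bot] at hmem
  rw [← hm]
  exact (congrArg jBar hmem).trans (map_zero jBar)

theorem mul_mem_filtration (hR : IsFilteredRing FR) (hM : IsFilteredModule FR FM)
    (hsep : κ.IsSeparated FR (quotFiltration FM (κ.obj M))) {p q : ℤ} {x : κ.Loc R} {y : κ.Loc M}
    (hx : x ∈ filtration FR FR p) (hy : y ∈ filtration FR FM q) :
    mul x y ∈ filtration FR FM (p + q) := by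
  obtain ⟨I, hI, h⟩ := hx
  refine ⟨_, κ.inf_mem_filter hI (colon_range_mem (mul x y)), fun n a ha hn => ?_⟩
  obtain ⟨b, hb, hba⟩ := h n a ha.1 hn
  obtain ⟨m, hm⟩ : ∃ m : M, j m = a • mul x y := ha.2
  have hby := smul_mem_filtration hR hb hy
  rw [← smul_mul_of_eq hba.symm y, ← hm, add_assoc] at hby
  rw [← hm]
  exact j_mem_map_of_mem_filtration hM hsep hby

end KernelFunctor.Loc

/-! ### Localization of filtered rings and modules -/

open KernelFunctor.Loc in
theorem mainTheorem1 {R : Type u} [Ring R] (FR : ℤ → AddSubgroup R)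
    (hFR : IsFilteredRing FR) (hZ : hFR.IsZariskian) (κ : KernelFunctor R) :
    (∀ (M : Type u) [AddCommGroup M] [Module R M] (FM : ℤ → AddSubgroup M),
      IsFilteredModule FR FM →
      κ.IsSeparated FR (quotFiltration FM (κ.obj M)) →
        IsFilteredModule FR (KernelFunctor.Loc.filtration (κ := κ) FR FM) ∧
        IsStrictFilteredHom FM (KernelFunctor.Loc.filtration (κ := κ) FR FM)
          (KernelFunctor.Loc.j (κ := κ) (M := M)).toAddMonoidHom ∧
        (IsSeparatedFiltration (quotFiltration FM (κ.obj M)) →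
          IsSeparatedFiltration (KernelFunctor.Loc.filtration (κ := κ) FR FM)) ∧
        IsFilteredModule (KernelFunctor.Loc.filtration (κ := κ) FR FR)
          (KernelFunctor.Loc.filtration (κ := κ) FR FM)) ∧
    (κ.IsSeparated FR (quotFiltration FR (κ.obj R)) →
      IsFilteredRing (KernelFunctor.Loc.filtration (κ := κ) FR FR) ∧
      IsSeparatedFiltration (KernelFunctor.Loc.filtration (κ := κ) FR FR) ∧
      IsStrictFilteredHom FR (KernelFunctor.Loc.filtration (κ := κ) FR FR)
        (KernelFunctor.Loc.jRing κ).toAddMonoidHom) := by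
  have hexh : ∀ (M : Type u) [AddCommGroup M] [Module R M] (FM : ℤ → AddSubgroup M),
      IsFilteredModule FR FM → ∀ q : κ.Loc M, ∃ γ : ℤ, q ∈ filtration FR FM γ :=
    fun M _ _ FM hM => exists_mem_filtration hFR hZ.noetherian hM
  refine ⟨fun M _ _ FM hM hsep => ⟨?_, isStrictFilteredHom_j hM hsep,
    isSeparatedFiltration_filtration hFR hM hsep, ?_⟩, fun hsep => ⟨?_, ?_, ?_⟩⟩
  · exact ⟨filtration_mono hM.mono, smul_mem_filtration hFR, hexh M FM hM⟩
  · exact ⟨filtration_mono hM.mono, mul_mem_filtration hFR hM hsep, hexh M FM hM⟩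
  · exact ⟨filtration_mono hFR.mono, j_mem_filtration hFR.isFilteredModule hFR.one_mem,
      mul_mem_filtration hFR hFR.isFilteredModule hsep, hexh R FR hFR.isFilteredModule⟩
  · exact isSeparatedFiltration_filtration hFR hFR.isFilteredModule hsep
      (hFR.isSeparatedFiltration_quotFiltration hZ _)
  · exact isStrictFilteredHom_j hFR.isFilteredModule hsep
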